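/- Let $\mathbf u=(u_1,\dots,u_n)\in\mathbb R^n$ with $0\le u_1\le\cdots\le u_n$. A vector $\mathbf a\in\mathbb R_{\ge0}^n$ with non-decreasing rearrangement $b_1\le\cdots\le b_n$ is a $\mathbf u$-parking function if $b_i\le u_i$ for all $i$; let $\mathrm{PF}(\mathbf u)\subset\mathbb R^n$ be the convex hull of all $\mathbf u$-parking functions. For a set $I$ of indices put $\Delta_I=\mathrm{conv}(\mathbf e_i : i\in I)$ and $\Delta^0_I=\mathrm{conv}(\mathbf 0,\Delta_I)$, and for $\emptyset\ne I\subseteq[n]$ put \[ y_I=\sum_{j=0}^{|I|-1}\binom{|I|-1}{j}(-1)^j\,u_{|I|-j}. \] A polytope $P$ is said to be the signed Minkowski sum $\sum_I y_I K_I$ of polytopes $K_I$ if $P+\sum_{y_I<0}(-y_I)K_I=\sum_{y_I>0}y_I K_I$ as ordinary Minkowski sums. A type $A$ generalized permutohedron is a polytope each of whose edges is parallel to $\mathbf e_i-\mathbf e_j$ for some $i\ne j$. Then the following hold. (1) $\mathrm{PF}(\mathbf u)$ is a polytope, and as a signed Minkowski sum \[ \mathrm{PF}(\mathbf u)=\sum_{\emptyset\ne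 I\subseteq[n]} y_I\,\Delta^0_I , \] where $y_I$ depends only on $|I|$. (2) There is a type $A$ generalized permutohedron $Q\subset\mathbb R^{\{0,1,\dots,n\}}$ that is the signed Minkowski sum \[ Q=\sum_{\emptyset\ne I\subseteq[n]} y_I\,\Delta_{\{0\}\cup I}, \] and the projection $\pi(x_0,x_1,\dots,x_n)=(x_1,\dots,x_n)$ satisfies $\pi(Q)=\mathrm{PF}(\mathbf u)$ and maps the affine hull of $Q$ bijectively onto that of $\mathrm{PF}(\mathbf u)$. (3) If $\mathrm{PF}(\mathbf u)$ is integral (all its vertices have integer coordinates), then all $y_I$ are integers, $Q$ is integral, and $\pi$ restricts to a bijection from the integer points of the affine hull of $Q$ to those of the affine hull of $\mathrm{PF}(\mathbf u)$. In particular, $\mathrm{PF}(\mathbf u)$ and $Q$ are integrally equivalent: there is an affine bijection between their affine hulls, carrying one polytope onto the other and integer points of the affine hulls bijectively to integer points. -/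

import Mathlib

open scoped Pointwise

noncomputable section

namespace ParkingPolytope

/-- `a` is a `u`-parking function: its entries are nonnegative and its non-decreasing
rearrangement `b` satisfies `b i ≤ u i` for all `i`. -/
def IsParkingFunction {n : ℕ} (u a : Fin n → ℝ) : Prop :=
  (∀ i, 0 ≤ a i) ∧ ∀ i, a (Tuple.sort a i) ≤ u i

/-- The parking function polytope: the convex hull of all `u`-parking functions. -/
def PF {n : ℕ} (u : Fin n → ℝ) : Set (Fin n → ℝ) :=
  convexHull ℝ {a | IsParkingFunction u a}

/-- A polytope: the convex hull of finitely many points. -/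
def IsPolytope {ι : Type*} (P : Set (ι → ℝ)) : Prop :=
  ∃ S : Set (ι → ℝ), S.Finite ∧ P = convexHull ℝ S

/-- The points with integer coordinates. -/
def latticePoints (ι : Type*) : Set (ι → ℝ) :=
  {x | ∀ i, ∃ k : ℤ, x i = k}

/-- A polytope is integral if all its vertices are lattice points. -/
def IsIntegralPolytope {ι : Type*} (P : Set (ι → ℝ)) : Prop :=
  IsPolytope P ∧ P.extremePoints ℝ ⊆ latticePoints ι

/-- `Δ_I`, the convex hull of the `e_i` with `i ∈ I`. -/
def simplex {ι : Type*} [DecidableEq ι] (I : Finset ι) : Set (ι → ℝ) :=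
  convexHull ℝ ((fun i => (Pi.single i 1 : ι → ℝ)) '' (I : Set ι))

/-- `Δ⁰_I`, the convex hull of the origin and `Δ_I`. -/
def simplexZero {ι : Type*} [DecidableEq ι] (I : Finset ι) : Set (ι → ℝ) :=
  convexHull ℝ (insert 0 (simplex I))

/-- `P = ∑_{a ∈ s} y_a K_a` as a signed Minkowski sum: `P` is a polytope, and moving the
summands with negative coefficients to the side of `P` gives an identity between ordinary
Minkowski sums. (By cancellation there is at most one such `P` if the `K_a` are nonempty
polytopes.) -/
def IsSignedMinkowskiSum {α ι : Type*} (P : Set (ι → ℝ)) (s : Finset α) (y : α → ℝ)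
    (K : α → Set (ι → ℝ)) : Prop :=
  IsPolytope P ∧
    P + ∑ a ∈ s, max (-y a) 0 • K a = ∑ a ∈ s, max (y a) 0 • K a

/-- `y_I = ∑_{j=0}^{|I|-1} C(|I|-1, j) (-1)^j u_{|I|-j}`. The entry `u_k` of the `1`-based
vector `u` is the value of `u` at the index `k - 1` of `Fin n`. -/
def coeffY {n : ℕ} (u : Fin n → ℝ) (I : Finset (Fin n)) : ℝ :=
  ∑ j : Fin I.card, ((I.card - 1).choose j : ℝ) * (-1) ^ (j : ℕ) *
    u ⟨I.card - j - 1, by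
      have h₁ := j.isLt
      have h₂ := card_finset_fin_le I
      omega⟩

/-- The nonempty subsets of `[n]`. -/
def nonemptySubsets (n : ℕ) : Finset (Finset (Fin n)) :=
  Finset.univ.filter fun I => I.Nonempty

/-- The subset `{0} ∪ I` of `[0,n]`, for `I ⊆ [n]`; here `[0,n]` is `Fin (n + 1)` and `[n]` is
embedded in it by `Fin.succ`. -/
def withZero {n : ℕ} (I : Finset (Fin n)) : Finset (Fin (n + 1)) :=
  insert 0 (I.image Fin.succ)

/-- The projection `(x_0, x_1, …, x_n) ↦ (x_1, …, x_n)`. -/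
def proj (n : ℕ) : (Fin (n + 1) → ℝ) →ᵃ[ℝ] (Fin n → ℝ) :=
  (LinearMap.funLeft ℝ ℝ (Fin.succ : Fin n → Fin (n + 1))).toAffineMap

/-- An edge of `P`: a one-dimensional face, a face being the set of points of `P` where some
linear functional is maximal on `P`. -/
def IsEdge {ι : Type*} (P F : Set (ι → ℝ)) : Prop :=
  IsExposed ℝ P F ∧ Module.finrank ℝ (vectorSpan ℝ F) = 1

/-- A type `A` generalized permutohedron: a polytope all of whose edges are parallel to some
`e_i - e_j` with `i ≠ j`. -/
def IsTypeAGenPermutohedron {ι : Type*} [DecidableEq ι] (P : Set (ι → ℝ)) : Prop :=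
  IsPolytope P ∧ ∀ F, IsEdge P F → ∃ i j : ι, i ≠ j ∧
    vectorSpan ℝ F = Submodule.span ℝ {(Pi.single i 1 - Pi.single j 1 : ι → ℝ)}

/-- The affine map `φ` restricts to an integral equivalence from `P` to `Q`: it is a bijection
from `aff P` to `aff Q` that carries `P` to `Q` and the lattice points of `aff P` bijectively
to those of `aff Q`. -/
def IsIntegralEquivalence {ι κ : Type*} (φ : (ι → ℝ) →ᵃ[ℝ] (κ → ℝ))
    (P : Set (ι → ℝ)) (Q : Set (κ → ℝ)) : Prop :=
  Set.BijOn φ (affineSpan ℝ P) (affineSpan ℝ Q) ∧ φ '' P = Q ∧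
    Set.BijOn φ (affineSpan ℝ P ∩ latticePoints ι) (affineSpan ℝ Q ∩ latticePoints κ)

/-- Integral equivalence of two integral polytopes. (An affine map between the affine hulls
always extends to the ambient spaces.) -/
def IntegrallyEquivalent {ι κ : Type*} (P : Set (ι → ℝ)) (Q : Set (κ → ℝ)) : Prop :=
  IsIntegralPolytope P ∧ IsIntegralPolytope Q ∧
    ∃ φ : (ι → ℝ) →ᵃ[ℝ] (κ → ℝ), IsIntegralEquivalence φ P Q

end ParkingPolytope

end

/-!
A compact convex set is determined by its support function, so (1) is an identity between functions
of a linear functional `l`. Let `σ` sort the values `w i = l e_i` increasingly. By the rearrangement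
inequality the support function of `PF u` at `l` is `∑ m, max (w (σ m)) 0 * u m`, and that of
`Δ⁰_I` is `max (w i) 0` for the `i ∈ I` that is last in the order given by `σ`. Since `y_I` is the
iterated forward difference `Δ^{|I|-1} u` at the first entry, Newton's formula says that the `y_I`
over all `I` with last element `σ m` add up to `u m`, and the two sides agree.

The polytope `Q` is the lift of `PF u` to the hyperplane `∑ x_i = ∑ y_I`; the lift of height `1`
carries `Δ⁰_I` to `Δ_{{0} ∪ I}`.

Faces of a signed Minkowski sum are the signed Minkowski sums of the faces. Hence a functional that
separates the points `e_i` is maximal at a single point of any face of `Q`. If an edge of `Q` were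
parallel to no `e_i - e_j`, some such functional would be constant on it. In the same way a
functional with positive increasing coefficients is maximal on `PF u` at the single point `u`, which
is therefore a vertex; so if `PF u` is integral, then so are `u`, all the `y_I` and the height of
`Q`.
-/

namespace ParkingPolytope

section Sums

variable {E α : Type*} [AddCommMonoid E] {s : Finset α} {K : α → Set E}

theorem nonempty_sum (h : ∀ a ∈ s, (K a).Nonempty) : (∑ a ∈ s, K a).Nonempty := by
  choose! x hx using h
  exact ⟨∑ a ∈ s, x a, Set.finsetSum_mem_finsetSum s K x hx⟩

theorem isCompact_sum [TopologicalSpace E] [ContinuousAdd E] (h : ∀ a ∈ s, IsCompact (K a)) :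
    IsCompact (∑ a ∈ s, K a) := by
  classical
  induction s using Finset.induction_on with
  | empty => simp only [Finset.sum_empty, ← Set.singleton_zero, isCompact_singleton]
  | insert a s ha ih =>
    rw [Finset.sum_insert ha]
    exact (h a (by simp)).add (ih fun b hb => h b (by simp [hb]))

end Sums

section Faces

variable {E α : Type*} [AddCommGroup E] [Module ℝ E] [TopologicalSpace E] (l : StrongDual ℝ E)

theorem toExposed_add (A B : Set E) : l.toExposed (A + B) = l.toExposed A + l.toExposed B := by
  ext x
  constructor
  · rintro ⟨⟨a, ha, b, hb, rfl⟩, hmax⟩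
    refine ⟨a, ⟨ha, fun a' ha' => ?_⟩, b, ⟨hb, fun b' hb' => ?_⟩, rfl⟩
    · simpa using hmax _ (Set.add_mem_add ha' hb)
    · simpa using hmax _ (Set.add_mem_add ha hb')
  · rintro ⟨a, ⟨ha, hamax⟩, b, ⟨hb, hbmax⟩, rfl⟩
    refine ⟨Set.add_mem_add ha hb, ?_⟩
    rintro _ ⟨a', ha', b', hb', rfl⟩
    simpa using add_le_add (hamax a' ha') (hbmax b' hb')

theorem toExposed_zero : l.toExposed (0 : Set E) = 0 := by
  ext x
  exact ⟨fun hx => hx.1, by rintro rfl; exact ⟨rfl, by rintro _ rfl; rfl⟩⟩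

theorem toExposed_sum (s : Finset α) (K : α → Set E) :
    l.toExposed (∑ a ∈ s, K a) = ∑ a ∈ s, l.toExposed (K a) := by
  classical
  induction s using Finset.induction_on with
  | empty => simp only [Finset.sum_empty, toExposed_zero]
  | insert a s ha ih => rw [Finset.sum_insert ha, Finset.sum_insert ha, toExposed_add, ih]

theorem toExposed_smul {c : ℝ} (hc : 0 ≤ c) {A : Set E} (hA : (l.toExposed A).Nonempty) :
    l.toExposed (c • A) = c • l.toExposed A := by
  rcases hc.eq_or_lt with rfl | hc
  · rw [Set.zero_smul_set hA, Set.zero_smul_set (hA.mono fun _ hx => hx.1), toExposed_zero]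
  · ext x
    constructor
    · rintro ⟨⟨a, ha, rfl⟩, hmax⟩
      refine Set.smul_mem_smul_set ⟨ha, fun b hb => ?_⟩
      simpa [hc] using hmax _ (Set.smul_mem_smul_set hb)
    · rintro ⟨a, ⟨ha, hmax⟩, rfl⟩
      refine ⟨Set.smul_mem_smul_set ha, ?_⟩
      rintro _ ⟨b, hb, rfl⟩
      simpa [hc] using hmax b hb

theorem toExposed_convexHull (S : Set E) :
    l.toExposed (convexHull ℝ S) = convexHull ℝ (l.toExposed S) := by
  apply Set.Subset.antisymm
  · rintro x ⟨hx, hmax⟩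
    let T : Set E := {z | l z ≤ l x ∧ (l z = l x → z ∈ convexHull ℝ (l.toExposed S))}
    have hST : S ⊆ T := fun z hz => ⟨hmax z (subset_convexHull ℝ S hz), fun hzx =>
      subset_convexHull ℝ _ ⟨hz, fun y hy => (hmax y (subset_convexHull ℝ S hy)).trans_eq hzx.symm⟩⟩
    have hT : Convex ℝ T := by
      refine convex_iff_forall_pos.2 fun y hy z hz a b ha hb hab => ?_
      have hle : a * l y + b * l z ≤ (a + b) * l x := by
        linarith [mul_le_mul_of_nonneg_left hy.1 ha.le, mul_le_mul_of_nonneg_left hz.1 hb.le]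
      rw [hab, one_mul] at hle
      refine ⟨by simpa using hle, fun heq => ?_⟩
      have heq : a * l y + b * l z = (a + b) * l x := by simpa [hab] using heq
      have hyx : l y = l x := le_antisymm hy.1 (by nlinarith [hz.1])
      have hzx : l z = l x := le_antisymm hz.1 (by nlinarith [hy.1])
      exact convex_convexHull ℝ _ (hy.2 hyx) (hz.2 hzx) ha.le hb.le hab
    exact (convexHull_min hST hT hx).2 rfl
  · refine convexHull_min (fun x hx => ⟨subset_convexHull ℝ S hx.1, ?_⟩)
      (ContinuousLinearMap.toExposed.isExposed.convex (convex_convexHull ℝ S))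
    exact convexHull_min hx.2 (convex_halfSpace_le l.toLinearMap.isLinear (l x))

variable {l}

theorem subsingleton_toExposed_convexHull {S : Set E} (hl : Set.InjOn l S) :
    (l.toExposed (convexHull ℝ S)).Subsingleton := by
  have hS : (l.toExposed S).Subsingleton := fun x hx y hy =>
    hl hx.1 hy.1 (le_antisymm (hy.2 x hx.1) (hx.2 y hy.1))
  rw [toExposed_convexHull]
  rcases hS.eq_empty_or_singleton with h | ⟨x, h⟩
  · rw [h, convexHull_empty]
    exact Set.subsingleton_empty
  · rw [h, convexHull_singleton]
    exact Set.subsingleton_singleton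

theorem nonempty_toExposed {A : Set E} (hA : IsCompact A) (hne : A.Nonempty) :
    (l.toExposed A).Nonempty :=
  hA.exists_isMaxOn hne l.continuous.continuousOn

end Faces

section SupportFunction

variable {E : Type*} [AddCommGroup E] [Module ℝ E] [TopologicalSpace E]

/-- The support function `l ↦ max {l x | x ∈ A}` of a nonempty compact set `A`, as a function on
the dual space. By the conventions for `sSup`, it is `0` if `A` is empty or `l` is unbounded above
on `A`. -/
noncomputable def supportFunction (A : Set E) (l : StrongDual ℝ E) : ℝ :=
  sSup (l '' A)

variable {A B : Set E} (l : StrongDual ℝ E)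

theorem le_supportFunction (hA : IsCompact A) {x : E} (hx : x ∈ A) :
    l x ≤ supportFunction A l :=
  le_csSup (hA.image l.continuous).bddAbove (Set.mem_image_of_mem l hx)

theorem supportFunction_add (hA : IsCompact A) (hA' : A.Nonempty) (hB : IsCompact B)
    (hB' : B.Nonempty) : supportFunction (A + B) l = supportFunction A l + supportFunction B l := by
  rw [supportFunction, Set.image_add,
    csSup_add (hA'.image l) (hA.image l.continuous).bddAbove (hB'.image l)
      (hB.image l.continuous).bddAbove]
  rfl

theorem supportFunction_smul {c : ℝ} (hc : 0 ≤ c) (A : Set E) :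
    supportFunction (c • A) l = c * supportFunction A l := by
  rw [supportFunction, image_smul_set, Real.sSup_smul_of_nonneg hc]
  rfl

theorem isGreatest_image_convexHull {l : StrongDual ℝ E} {r : ℝ} (h : IsGreatest (l '' A) r) :
    IsGreatest (l '' convexHull ℝ A) r := by
  refine ⟨Set.image_mono (subset_convexHull ℝ A) h.1, ?_⟩
  have hA : A ⊆ {x | l x ≤ r} := fun x hx => h.2 (Set.mem_image_of_mem l hx)
  rintro _ ⟨x, hx, rfl⟩
  exact convexHull_min hA (convex_halfSpace_le l.toLinearMap.isLinear r) hx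

section Sum

variable [ContinuousAdd E] {α : Type*} {s : Finset α} {K : α → Set E}

theorem supportFunction_sum (hK : ∀ a ∈ s, IsCompact (K a)) (hne : ∀ a ∈ s, (K a).Nonempty) :
    supportFunction (∑ a ∈ s, K a) l = ∑ a ∈ s, supportFunction (K a) l := by
  classical
  induction s using Finset.induction_on with
  | empty => simp [supportFunction]
  | insert a s ha ih =>
    rw [Finset.forall_mem_insert] at hK hne
    rw [Finset.sum_insert ha, Finset.sum_insert ha, ← ih hK.2 hne.2,
      supportFunction_add l hK.1 hne.1 (isCompact_sum hK.2) (nonempty_sum hne.2)]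

end Sum

section Separation

variable [IsTopologicalAddGroup E] [ContinuousSMul ℝ E] [LocallyConvexSpace ℝ E]

theorem subset_of_forall_exists_le (hB : IsClosed B) (hconv : Convex ℝ B)
    (h : ∀ l : StrongDual ℝ E, ∀ x ∈ A, ∃ y ∈ B, l x ≤ l y) : A ⊆ B := by
  rw [← iInter_halfSpaces_eq hconv hB]
  exact fun x hx => Set.mem_iInter.2 fun l => h l x hx

theorem subset_of_supportFunction_le [T2Space E] (hA : IsCompact A) (hB : IsCompact B)
    (hB' : B.Nonempty) (hconv : Convex ℝ B)
    (h : ∀ l, supportFunction A l ≤ supportFunction B l) : A ⊆ B := by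
  refine subset_of_forall_exists_le hB.isClosed hconv fun l x hx => ?_
  obtain ⟨y, hy, hmax⟩ := hB.exists_sSup_image_eq hB' l.continuous.continuousOn
  exact ⟨y, hy, ((le_supportFunction l hA hx).trans (h l)).trans_eq hmax⟩

theorem eq_of_supportFunction_eq [T2Space E] (hA : IsCompact A) (hA' : A.Nonempty)
    (hAconv : Convex ℝ A) (hB : IsCompact B) (hB' : B.Nonempty) (hBconv : Convex ℝ B)
    (h : ∀ l, supportFunction A l = supportFunction B l) : A = B :=
  (subset_of_supportFunction_le hA hB hB' hBconv fun l => (h l).le).antisymm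
    (subset_of_supportFunction_le hB hA hA' hAconv fun l => (h l).ge)

end Separation

end SupportFunction

section Polytope

variable {ι κ : Type*} {P : Set (ι → ℝ)}

theorem IsPolytope.isCompact (hP : IsPolytope P) : IsCompact P := by
  obtain ⟨S, hS, rfl⟩ := hP
  exact hS.isCompact_convexHull (𝕜 := ℝ)

theorem IsPolytope.convex (hP : IsPolytope P) : Convex ℝ P := by
  obtain ⟨S, -, rfl⟩ := hP
  exact convex_convexHull ℝ S

theorem IsPolytope.image (hP : IsPolytope P) (f : (ι → ℝ) →ᵃ[ℝ] (κ → ℝ)) :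
    IsPolytope (f '' P) := by
  obtain ⟨S, hS, rfl⟩ := hP
  exact ⟨f '' S, hS.image f, f.image_convexHull S⟩

theorem IsPolytope.toExposed (hP : IsPolytope P) (l : StrongDual ℝ (ι → ℝ)) :
    IsPolytope (l.toExposed P) := by
  obtain ⟨S, hS, rfl⟩ := hP
  exact ⟨l.toExposed S, hS.subset fun _ hx => hx.1, toExposed_convexHull l S⟩

variable [DecidableEq ι] (I : Finset ι)

theorem isPolytope_simplex : IsPolytope (simplex I) :=
  ⟨_, I.finite_toSet.image _, rfl⟩

theorem simplexZero_eq : simplexZero I =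
    convexHull ℝ (insert 0 ((fun i => (Pi.single i 1 : ι → ℝ)) '' (I : Set ι))) := by
  rw [simplexZero, simplex, Set.insert_eq, Set.insert_eq, convexHull_convexHull_union_right]

theorem isPolytope_simplexZero : IsPolytope (simplexZero I) :=
  ⟨_, (I.finite_toSet.image _).insert 0, simplexZero_eq I⟩

theorem nonempty_simplexZero : (simplexZero I).Nonempty :=
  ⟨0, subset_convexHull ℝ _ (Set.mem_insert _ _)⟩

end Polytope

theorem add_max_neg_zero (r : ℝ) : r + max (-r) 0 = max r 0 :=
  eq_sub_iff_add_eq.1 (max_zero_sub_max_neg_zero_eq_self r).symm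

namespace IsSignedMinkowskiSum

variable {α ι κ : Type*} {P : Set (ι → ℝ)} {s : Finset α} {y : α → ℝ} {K : α → Set (ι → ℝ)}

theorem of_supportFunction (hP : IsPolytope P) (hP' : P.Nonempty)
    (hK : ∀ a ∈ s, IsPolytope (K a)) (hK' : ∀ a ∈ s, (K a).Nonempty)
    (h : ∀ l, supportFunction P l = ∑ a ∈ s, y a * supportFunction (K a) l) :
    IsSignedMinkowskiSum P s y K := by
  have hcompact (c : α → ℝ) : ∀ a ∈ s, IsCompact (c a • K a) := fun a ha =>
    (hK a ha).isCompact.smul (c a)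
  have hne (c : α → ℝ) : ∀ a ∈ s, (c a • K a).Nonempty := fun a ha => (hK' a ha).smul_set
  have hconv (c : α → ℝ) : Convex ℝ (∑ a ∈ s, c a • K a) :=
    convex_sum _ fun a ha => (hK a ha).convex.smul (c a)
  refine ⟨hP, eq_of_supportFunction_eq (hP.isCompact.add (isCompact_sum (hcompact _)))
    (hP'.add (nonempty_sum (hne _))) (hP.convex.add (hconv _)) (isCompact_sum (hcompact _))
    (nonempty_sum (hne _)) (hconv _) fun l => ?_⟩
  rw [supportFunction_add l hP.isCompact hP' (isCompact_sum (hcompact _)) (nonempty_sum (hne _)),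
    supportFunction_sum l (hcompact _) (hne _), supportFunction_sum l (hcompact _) (hne _), h,
    ← Finset.sum_add_distrib]
  refine Finset.sum_congr rfl fun a _ => ?_
  rw [supportFunction_smul l (le_max_right _ _), supportFunction_smul l (le_max_right _ _),
    ← add_mul, add_max_neg_zero]

theorem toExposed (h : IsSignedMinkowskiSum P s y K) (hK : ∀ a ∈ s, IsCompact (K a))
    (hK' : ∀ a ∈ s, (K a).Nonempty) (l : StrongDual ℝ (ι → ℝ)) :
    IsSignedMinkowskiSum (l.toExposed P) s y fun a => l.toExposed (K a) := by
  have hsum (c : α → ℝ) (hc : ∀ a, 0 ≤ c a) :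
      l.toExposed (∑ a ∈ s, c a • K a) = ∑ a ∈ s, c a • l.toExposed (K a) := by
    rw [toExposed_sum]
    exact Finset.sum_congr rfl fun a ha =>
      toExposed_smul l (hc a) (nonempty_toExposed (hK a ha) (hK' a ha))
  refine ⟨h.1.toExposed l, ?_⟩
  rw [← hsum _ fun a => le_max_right _ _, ← hsum _ fun a => le_max_right _ _, ← h.2, toExposed_add]

theorem subsingleton (h : IsSignedMinkowskiSum P s y K) (hK : ∀ a ∈ s, (K a).Subsingleton)
    (hK' : ∀ a ∈ s, (K a).Nonempty) : P.Subsingleton := by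
  choose! x hx using hK'
  have hsum (c : α → ℝ) : ∑ a ∈ s, c a • K a = {∑ a ∈ s, c a • x a} := by
    rw [← Set.finsetSum_singleton]
    refine Finset.sum_congr rfl fun a ha => ?_
    rw [(hK a ha).eq_singleton_of_mem (hx a ha), Set.smul_set_singleton]
  have hP := h.2
  rw [hsum, hsum] at hP
  intro p hp q hq
  have hmem {r} (hr : r ∈ P) := hP.subset (Set.add_mem_add hr (Set.mem_singleton _))
  exact add_right_cancel ((hmem hp).trans (hmem hq).symm)

theorem image_add (h : IsSignedMinkowskiSum P s y K)
    (L : (ι → ℝ) →ₗ[ℝ] (κ → ℝ)) (v : κ → ℝ) :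
    IsSignedMinkowskiSum ((fun x => L x + (∑ a ∈ s, y a) • v) '' P) s y
      fun a => (fun x => L x + v) '' K a := by
  have himage (A : Set (ι → ℝ)) (w : κ → ℝ) : (fun x => L x + w) '' A = L '' A + {w} := by
    rw [Set.add_singleton, Set.image_image]
  have hsum (c : α → ℝ) : ∑ a ∈ s, c a • ((fun x => L x + v) '' K a) =
      L '' (∑ a ∈ s, c a • K a) + {(∑ a ∈ s, c a) • v} := by
    simp only [himage, smul_add, Set.smul_set_singleton, Finset.sum_add_distrib,
      Set.finsetSum_singleton, Set.image_finsetSum, image_smul_set, Finset.sum_smul]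
  refine ⟨h.1.image (L.toAffineMap + AffineMap.const ℝ _ ((∑ a ∈ s, y a) • v)), ?_⟩
  rw [hsum, hsum, himage, ← h.2, Set.image_add, add_add_add_comm, Set.singleton_add_singleton,
    ← add_smul, ← Finset.sum_add_distrib]
  simp only [add_max_neg_zero]

end IsSignedMinkowskiSum

section Edges

theorem exists_dual_injective_comp {K V ι : Type*} [Field K] [Infinite K] [AddCommGroup V]
    [Module K V] [Finite ι] (e : ι → V) (W : Submodule K V)
    (h : ∀ i j, i ≠ j → e i - e j ∉ W) :
    ∃ p : Module.Dual K V, (∀ x ∈ W, p x = 0) ∧ Function.Injective (p ∘ e) := by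
  obtain ⟨q, hq⟩ := Module.exists_dual_forall_apply_ne_zero (K := K)
    (fun ij : {ij : ι × ι // ij.1 ≠ ij.2} => W.mkQ (e ij.1.1 - e ij.1.2)) fun ij h₀ =>
      h _ _ ij.2 ((Submodule.Quotient.mk_eq_zero W).1 h₀)
  refine ⟨q ∘ₗ W.mkQ, fun x hx => ?_, fun i j hij => ?_⟩
  · rw [LinearMap.comp_apply, Submodule.mkQ_apply, (Submodule.Quotient.mk_eq_zero W).2 hx, map_zero]
  · by_contra hne
    refine hq ⟨(i, j), hne⟩ ?_
    rw [map_sub, map_sub, sub_eq_zero]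
    exact hij

variable {α ι : Type*} [DecidableEq ι]

theorem single_sub_single_ne_zero {i j : ι} (hij : i ≠ j) :
    (Pi.single i 1 - Pi.single j 1 : ι → ℝ) ≠ 0 := by
  rw [sub_ne_zero]
  exact fun h => by simpa [hij] using congrFun h i

theorem nonempty_simplex {I : Finset ι} (hI : I.Nonempty) : (simplex I).Nonempty :=
  (hI.to_set.image _).convexHull

theorem IsSignedMinkowskiSum.exists_single_sub_single_mem_vectorSpan [Finite ι]
    {P : Set (ι → ℝ)} {s : Finset α} {y : α → ℝ} {I : α → Finset ι}
    (h : IsSignedMinkowskiSum P s y fun a => simplex (I a)) (hI : ∀ a ∈ s, (I a).Nonempty)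
    {l : StrongDual ℝ (ι → ℝ)} (hl : ¬ (l.toExposed P).Subsingleton) :
    ∃ i j, i ≠ j ∧ (Pi.single i 1 - Pi.single j 1 : ι → ℝ) ∈ vectorSpan ℝ (l.toExposed P) := by
  by_contra! hnot
  obtain ⟨q, hq₀, hq⟩ := exists_dual_injective_comp _ _ hnot
  let p : StrongDual ℝ (ι → ℝ) := q.toContinuousLinearMap
  have hne : ∀ a ∈ s, (simplex (I a)).Nonempty := fun a ha => nonempty_simplex (hI a ha)
  have hface := h.toExposed (fun a _ => (isPolytope_simplex (I a)).isCompact) hne l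
  have hcompact : ∀ a ∈ s, IsCompact (l.toExposed (simplex (I a))) := fun a _ =>
    ((isPolytope_simplex (I a)).toExposed l).isCompact
  have hne_face : ∀ a ∈ s, (l.toExposed (simplex (I a))).Nonempty := fun a ha =>
    nonempty_toExposed (isPolytope_simplex (I a)).isCompact (hne a ha)
  -- `p` is injective on the vertices of every summand, yet constant on the face of `P`.
  have hsub : (p.toExposed (l.toExposed P)).Subsingleton := by
    refine (hface.toExposed hcompact hne_face p).subsingleton (fun a _ => ?_) fun a ha =>
      nonempty_toExposed (hcompact a ha) (hne_face a ha)
    rw [simplex, toExposed_convexHull]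
    refine subsingleton_toExposed_convexHull (hq.injOn_range.mono ?_)
    exact fun x hx => Set.image_subset_range _ _ hx.1
  have hconst : p.toExposed (l.toExposed P) = l.toExposed P :=
    Set.Subset.antisymm (fun x hx => hx.1) fun x hx => ⟨hx, fun z hz => by
      refine (sub_eq_zero.1 ?_).le
      rw [← map_sub]
      exact hq₀ _ (vsub_mem_vectorSpan ℝ hz hx)⟩
  exact hl (hconst ▸ hsub)

theorem IsSignedMinkowskiSum.isTypeAGenPermutohedron [Finite ι] {P : Set (ι → ℝ)} {s : Finset α}
    {y : α → ℝ} {I : α → Finset ι} (h : IsSignedMinkowskiSum P s y fun a => simplex (I a))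
    (hI : ∀ a ∈ s, (I a).Nonempty) : IsTypeAGenPermutohedron P := by
  refine ⟨h.1, fun F ⟨hF, hdim⟩ => ?_⟩
  have hFsub : ¬ F.Subsingleton := fun hsub => by
    rw [vectorSpan_of_subsingleton ℝ hsub, finrank_bot] at hdim
    exact zero_ne_one hdim
  obtain ⟨l, hl⟩ := hF (Set.not_subsingleton_iff.1 hFsub).nonempty
  change F = l.toExposed P at hl
  rw [hl] at hFsub hdim ⊢
  obtain ⟨i, j, hij, hmem⟩ := h.exists_single_sub_single_mem_vectorSpan hI hFsub
  refine ⟨i, j, hij, (Submodule.eq_of_le_of_finrank_eq ?_ ?_).symm⟩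
  · exact Submodule.span_le.2 (Set.singleton_subset_iff.2 hmem)
  · rw [finrank_span_singleton (single_sub_single_ne_zero hij), hdim]

end Edges

section Parking

theorem exists_le_le_apply {α : Type*} [LinearOrder α] [LocallyFiniteOrderBot α] {f : α → α}
    (hf : Function.Injective f) (i : α) : ∃ k ≤ i, i ≤ f k := by
  by_contra! h
  have hcard : (Finset.Iic i).card ≤ (Finset.Iio i).card :=
    Finset.card_le_card_of_injOn f (by simpa [Set.MapsTo] using h) hf.injOn
  rw [← Finset.Iio_insert, Finset.card_insert_of_notMem Finset.notMem_Iio_self] at hcard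
  exact Nat.not_succ_le_self _ hcard

theorem strongDual_apply_eq_sum {ι : Type*} [Fintype ι] [DecidableEq ι]
    (l : StrongDual ℝ (ι → ℝ)) (x : ι → ℝ) : l x = ∑ i, l (Pi.single i 1) * x i := by
  conv_lhs => rw [pi_eq_sum_univ' x, map_sum]
  simp only [map_smul, smul_eq_mul, mul_comm]

variable {n : ℕ} {u : Fin n → ℝ}

theorem isParkingFunction_of_perm (hu : Monotone u) {a : Fin n → ℝ} (ha : ∀ i, 0 ≤ a i)
    (σ : Equiv.Perm (Fin n)) (h : ∀ i, a (σ i) ≤ u i) : IsParkingFunction u a := by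
  refine ⟨ha, fun i => ?_⟩
  obtain ⟨k, hki, hik⟩ := exists_le_le_apply (σ.trans (Tuple.sort a).symm).injective i
  calc a (Tuple.sort a i) ≤ a (Tuple.sort a ((Tuple.sort a).symm (σ k))) :=
        Tuple.monotone_sort a hik
    _ = a (σ k) := by rw [Equiv.apply_symm_apply]
    _ ≤ u k := h k
    _ ≤ u i := hu hki

/-- The `u`-parking functions all of whose entries are `0` or entries of `u`: a finite set of
parking functions that contains all vertices of `PF u`. -/
def parkingVertices (u : Fin n → ℝ) : Set (Fin n → ℝ) :=
  {a | IsParkingFunction u a ∧ ∀ i, a i ∈ insert 0 (Set.range u)}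

theorem finite_parkingVertices (u : Fin n → ℝ) : (parkingVertices u).Finite :=
  (Set.Finite.pi' fun _ => (Set.finite_range u).insert 0).subset fun _ ha => ha.2

variable {l : StrongDual ℝ (Fin n → ℝ)} {σ : Equiv.Perm (Fin n)}

theorem IsParkingFunction.apply_le {a : Fin n → ℝ} (ha : IsParkingFunction u a)
    (hσ : Monotone fun m => l (Pi.single (σ m) 1)) :
    l a ≤ ∑ m, max (l (Pi.single (σ m) 1)) 0 * u m := by
  set w : Fin n → ℝ := fun i => l (Pi.single i 1)
  set τ := Tuple.sort a
  have hw : Monotone fun m => max (w (σ m)) 0 := fun i j hij => max_le_max_right 0 (hσ hij)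
  calc l a = ∑ i, w i * a i := strongDual_apply_eq_sum l a
    _ ≤ ∑ i, max (w i) 0 * a i :=
        Finset.sum_le_sum fun i _ => mul_le_mul_of_nonneg_right (le_max_left _ _) (ha.1 i)
    _ = ∑ m, max (w (σ m)) 0 * (a ∘ τ) ((σ.trans τ.symm) m) := by
        simpa using (Equiv.sum_comp σ fun i => max (w i) 0 * a i).symm
    _ ≤ ∑ m, max (w (σ m)) 0 * (a ∘ τ) m :=
        (hw.monovary (Tuple.monotone_sort a)).sum_mul_comp_perm_le_sum_mul
    _ ≤ ∑ m, max (w (σ m)) 0 * u m :=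
        Finset.sum_le_sum fun m _ => mul_le_mul_of_nonneg_left (ha.2 m) (le_max_right _ _)

variable (hu₀ : ∀ i, 0 ≤ u i) (hu : Monotone u)

include hu₀ hu

theorem isParkingFunction_self : IsParkingFunction u u :=
  isParkingFunction_of_perm hu hu₀ (Equiv.refl _) fun _ => le_rfl

theorem isGreatest_image_parkingVertices (hσ : Monotone fun m => l (Pi.single (σ m) 1)) :
    IsGreatest (l '' parkingVertices u) (∑ m, max (l (Pi.single (σ m) 1)) 0 * u m) := by
  let a : Fin n → ℝ := fun i => if 0 < l (Pi.single i 1) then u (σ.symm i) else 0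
  have ha_nonneg (i) : 0 ≤ a i := by
    dsimp only [a]
    split_ifs
    exacts [hu₀ _, le_rfl]
  have ha_le (i) : a (σ i) ≤ u i := by
    dsimp only [a]
    rw [Equiv.symm_apply_apply]
    split_ifs
    exacts [le_rfl, hu₀ _]
  have ha_mem (i) : a i ∈ insert 0 (Set.range u) := by
    dsimp only [a]
    split_ifs
    exacts [Or.inr ⟨_, rfl⟩, Or.inl rfl]
  refine ⟨⟨a, ⟨isParkingFunction_of_perm hu ha_nonneg σ ha_le, ha_mem⟩, ?_⟩,
    Set.forall_mem_image.2 fun b hb => hb.1.apply_le hσ⟩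
  rw [strongDual_apply_eq_sum, ← Equiv.sum_comp σ]
  refine Finset.sum_congr rfl fun m _ => ?_
  dsimp only [a]
  rw [Equiv.symm_apply_apply]
  split_ifs with h
  · rw [max_eq_left h.le]
  · rw [max_eq_right (not_lt.1 h), mul_zero, zero_mul]

theorem PF_eq_convexHull_parkingVertices : PF u = convexHull ℝ (parkingVertices u) := by
  refine Set.Subset.antisymm (convexHull_min ?_ (convex_convexHull ℝ _))
    (convexHull_mono fun a ha => ha.1)
  refine subset_of_forall_exists_le
    ((finite_parkingVertices u).isCompact_convexHull (𝕜 := ℝ)).isClosed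
    (convex_convexHull ℝ _) fun l a ha => ?_
  have hσ := Tuple.monotone_sort fun i => l (Pi.single i 1)
  obtain ⟨⟨v, hv, hvl⟩, -⟩ := isGreatest_image_parkingVertices hu₀ hu hσ
  exact ⟨v, subset_convexHull ℝ _ hv, (ha.apply_le hσ).trans_eq hvl.symm⟩

theorem isPolytope_PF : IsPolytope (PF u) :=
  ⟨_, finite_parkingVertices u, PF_eq_convexHull_parkingVertices hu₀ hu⟩

theorem supportFunction_PF (hσ : Monotone fun m => l (Pi.single (σ m) 1)) :
    supportFunction (PF u) l = ∑ m, max (l (Pi.single (σ m) 1)) 0 * u m := by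
  rw [PF_eq_convexHull_parkingVertices hu₀ hu]
  exact (isGreatest_image_convexHull (isGreatest_image_parkingVertices hu₀ hu hσ)).csSup_eq

end Parking

section Coefficients

theorem sum_filter_nonempty_eq_sum_sum_insert {α M : Type*} [Fintype α] [LinearOrder α]
    [LocallyFiniteOrderBot α] [AddCommMonoid M] (F : Finset α → M) :
    ∑ I with I.Nonempty, F I = ∑ m, ∑ J ∈ (Finset.Iio m).powerset, F (insert m J) := by
  rw [Finset.sum_sigma']
  have hne {I : Finset α} (hI : I ∈ Finset.univ.filter Finset.Nonempty) : I.Nonempty :=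
    (Finset.mem_filter.1 hI).2
  refine (Finset.sum_bij' (fun x _ => insert x.1 x.2)
    (fun I hI => ⟨I.max' (hne hI), I.erase (I.max' (hne hI))⟩) ?_ ?_ ?_ ?_ ?_).symm
  · simp
  · intro I hI
    simp only [Finset.mem_sigma, Finset.mem_univ, Finset.mem_powerset, true_and]
    exact fun i hi => Finset.mem_Iio.2 (I.lt_max'_of_mem_erase_max' (hne hI) hi)
  · rintro ⟨m, J⟩ hJ
    have hJ : ∀ j ∈ J, j < m := by simpa [Finset.subset_iff] using hJ
    have hmax : (insert m J).max' (Finset.insert_nonempty m J) = m :=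
      (Finset.max'_eq_iff _ _ _).2 ⟨Finset.mem_insert_self m J, by
        simpa using fun j hj => (hJ j hj).le⟩
    have hm : m ∉ J := fun hm => (hJ m hm).false
    simp only [hmax, Finset.erase_insert hm]
  · intro I hI
    exact Finset.insert_erase (I.max'_mem (hne hI))
  · intros; rfl

variable {n : ℕ} {u : Fin n → ℝ}

theorem coeffY_eq_sum_range {f : ℕ → ℝ} (hf : ∀ i : Fin n, f i = u i) (I : Finset (Fin n)) :
    coeffY u I = ∑ j ∈ Finset.range I.card,
      ((I.card - 1).choose j : ℝ) * (-1) ^ j * f (I.card - j - 1) := by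
  simp only [coeffY, ← hf, Finset.sum_range]

theorem coeffY_eq_fwdDiff {f : ℕ → ℝ} (hf : ∀ i : Fin n, f i = u i) {I : Finset (Fin n)} {k : ℕ}
    (hI : I.card = k + 1) : coeffY u I = (fwdDiff 1)^[k] f 0 := by
  rw [coeffY_eq_sum_range hf, hI, fwdDiff_iter_eq_sum_shift, ← Finset.sum_range_reflect]
  refine Finset.sum_congr rfl fun j hj => ?_
  have hj' : j ≤ k := by simpa [Nat.lt_succ_iff] using hj
  rw [show k + 1 - 1 - j = k - j by omega, show k + 1 - 1 = k by omega,
    show k + 1 - (k - j) - 1 = j by omega, Nat.choose_symm hj']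
  simp only [zsmul_eq_mul, smul_eq_mul, mul_one, zero_add, Int.cast_mul, Int.cast_pow,
    Int.cast_neg, Int.cast_one, Int.cast_natCast]
  ring

theorem exists_forall_fin_val_eq (u : Fin n → ℝ) : ∃ f : ℕ → ℝ, ∀ i : Fin n, f i = u i :=
  ⟨Function.extend Fin.val u 0, Fin.val_injective.extend_apply u 0⟩

theorem coeffY_congr (u : Fin n → ℝ) {I J : Finset (Fin n)} (h : I.card = J.card) :
    coeffY u I = coeffY u J := by
  obtain ⟨f, hf⟩ := exists_forall_fin_val_eq u
  rw [coeffY_eq_sum_range hf, coeffY_eq_sum_range hf, h]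

theorem exists_int_coeffY_eq (hu : ∀ i, ∃ k : ℤ, u i = k) (I : Finset (Fin n)) :
    ∃ k : ℤ, coeffY u I = k := by
  choose v hv using hu
  simp only [coeffY, hv]
  exact ⟨∑ j : Fin I.card, ((I.card - 1).choose j : ℤ) * (-1) ^ (j : ℕ) * v _, by push_cast; rfl⟩

theorem sum_coeffY_insert (u : Fin n → ℝ) (m : Fin n) :
    ∑ J ∈ (Finset.Iio m).powerset, coeffY u (insert m J) = u m := by
  obtain ⟨f, hf⟩ := exists_forall_fin_val_eq u
  have hcoeff : ∀ J ∈ (Finset.Iio m).powerset, coeffY u (insert m J) = (fwdDiff 1)^[J.card] f 0 :=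
    fun J hJ => coeffY_eq_fwdDiff hf (Finset.card_insert_of_notMem fun hm =>
      (Finset.mem_Iio.1 (Finset.mem_powerset.1 hJ hm)).false)
  rw [Finset.sum_congr rfl hcoeff,
    Finset.sum_powerset_apply_card (fun k => (fwdDiff 1)^[k] f 0), Fin.card_Iio,
    ← shift_eq_sum_fwdDiff_iter]
  simp [hf]

theorem sum_coeffY_mul (u g : Fin n → ℝ) {F : Finset (Fin n) → ℝ}
    (hF : ∀ m, ∀ J ⊆ Finset.Iio m, F (insert m J) = g m) :
    ∑ I ∈ nonemptySubsets n, coeffY u I * F I = ∑ m, g m * u m := by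
  rw [nonemptySubsets, sum_filter_nonempty_eq_sum_sum_insert]
  refine Finset.sum_congr rfl fun m _ => ?_
  rw [← sum_coeffY_insert u m, Finset.mul_sum]
  refine Finset.sum_congr rfl fun J hJ => ?_
  rw [hF m J (Finset.mem_powerset.1 hJ), mul_comm]

theorem sum_coeffY_mul_comp_map (u : Fin n → ℝ) (σ : Equiv.Perm (Fin n))
    (F : Finset (Fin n) → ℝ) :
    ∑ I ∈ nonemptySubsets n, coeffY u I * F (I.map σ.toEmbedding) =
      ∑ I ∈ nonemptySubsets n, coeffY u I * F I :=
  Finset.sum_equiv σ.finsetCongr (by simp [nonemptySubsets]) fun I _ => by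
    rw [Equiv.finsetCongr_apply, coeffY_congr u (Finset.card_map _)]

end Coefficients

section SignedSum

variable {n : ℕ} {u : Fin n → ℝ}

theorem supportFunction_simplexZero {ι : Type*} [DecidableEq ι] {l : StrongDual ℝ (ι → ℝ)}
    {I : Finset ι} {k : ι} (hk : k ∈ I)
    (hmax : ∀ i ∈ I, l (Pi.single i 1) ≤ l (Pi.single k 1)) :
    supportFunction (simplexZero I) l = max (l (Pi.single k 1)) 0 := by
  rw [simplexZero_eq]
  refine (isGreatest_image_convexHull ⟨?_, ?_⟩).csSup_eq
  · rcases le_total (l (Pi.single k 1)) 0 with h | h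
    · exact ⟨0, Set.mem_insert _ _, by rw [map_zero, max_eq_right h]⟩
    · exact ⟨Pi.single k 1, Or.inr ⟨k, hk, rfl⟩, (max_eq_left h).symm⟩
  · rintro _ ⟨_, rfl | ⟨i, hi, rfl⟩, rfl⟩
    · rw [map_zero]
      exact le_max_right _ _
    · exact (hmax i hi).trans (le_max_left _ _)

theorem isSignedMinkowskiSum_PF (hu₀ : ∀ i, 0 ≤ u i) (hu : Monotone u) :
    IsSignedMinkowskiSum (PF u) (nonemptySubsets n) (coeffY u) simplexZero := by
  refine .of_supportFunction (isPolytope_PF hu₀ hu)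
    ⟨u, subset_convexHull ℝ _ (isParkingFunction_self hu₀ hu)⟩
    (fun I _ => isPolytope_simplexZero I) (fun I _ => nonempty_simplexZero I) fun l => ?_
  set σ := Tuple.sort fun i => l (Pi.single i 1)
  have hσ : Monotone fun m => l (Pi.single (σ m) 1) :=
    Tuple.monotone_sort fun i => l (Pi.single i 1)
  rw [supportFunction_PF hu₀ hu hσ, ← sum_coeffY_mul_comp_map u σ]
  refine (sum_coeffY_mul u _ fun m J hJ => ?_).symm
  refine supportFunction_simplexZero (by simp) fun i hi => ?_
  obtain ⟨j, hj, rfl⟩ := Finset.mem_map.1 hi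
  rcases Finset.mem_insert.1 hj with rfl | hj
  exacts [le_rfl, hσ (Finset.mem_Iio.1 (hJ hj)).le]

end SignedSum

section Vertex

theorem mem_exposedPoints_of_subsingleton_toExposed {E : Type*} [AddCommGroup E] [Module ℝ E]
    [TopologicalSpace E] {A : Set E} {x : E} {l : StrongDual ℝ E} (hx : x ∈ l.toExposed A)
    (hl : (l.toExposed A).Subsingleton) : x ∈ A.exposedPoints ℝ :=
  ⟨hx.1, l, fun y hy => ⟨hx.2 y hy, fun hxy => hl ⟨hy, fun z hz => (hx.2 z hz).trans hxy⟩ hx⟩⟩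

theorem subsingleton_toExposed_simplexZero {ι : Type*} [DecidableEq ι] {l : StrongDual ℝ (ι → ℝ)}
    (hinj : Function.Injective fun i => l (Pi.single i 1)) (hne : ∀ i, l (Pi.single i 1) ≠ 0)
    (I : Finset ι) : (l.toExposed (simplexZero I)).Subsingleton := by
  rw [simplexZero_eq]
  refine subsingleton_toExposed_convexHull ?_
  rintro _ (rfl | ⟨i, -, rfl⟩) _ (rfl | ⟨j, -, rfl⟩) hij
  · rfl
  · exact absurd (hij.symm.trans (map_zero l)) (hne j)
  · exact absurd (hij.trans (map_zero l)) (hne i)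
  · rw [hinj hij]

theorem mem_extremePoints_PF {n : ℕ} {u : Fin n → ℝ} (hu₀ : ∀ i, 0 ≤ u i) (hu : Monotone u) :
    u ∈ (PF u).extremePoints ℝ := by
  let l : StrongDual ℝ (Fin n → ℝ) := ∑ i : Fin n, ((i : ℝ) + 1) • ContinuousLinearMap.proj i
  have hl (i) : l (Pi.single i 1) = (i : ℝ) + 1 := by simp [l, Pi.single_apply]
  have hl_pos (i) : 0 < l (Pi.single i 1) := by rw [hl]; positivity
  have hl_strictMono : StrictMono fun i => l (Pi.single i 1) := fun i j hij => by
    simpa only [hl, add_lt_add_iff_right, Nat.cast_lt, Fin.val_fin_lt] using hij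
  have hmem : u ∈ PF u := subset_convexHull ℝ _ (isParkingFunction_self hu₀ hu)
  have hmax : supportFunction (PF u) l = l u := by
    rw [supportFunction_PF (σ := Equiv.refl _) hu₀ hu hl_strictMono.monotone,
      strongDual_apply_eq_sum l u]
    simp only [Equiv.refl_apply, max_eq_left (hl_pos _).le]
  have hface : u ∈ l.toExposed (PF u) :=
    ⟨hmem, fun x hx => (le_supportFunction l (isPolytope_PF hu₀ hu).isCompact hx).trans_eq hmax⟩
  refine exposedPoints_subset_extremePoints
    (mem_exposedPoints_of_subsingleton_toExposed hface ?_)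
  have hcompact (I : Finset (Fin n)) : IsCompact (simplexZero I) :=
    (isPolytope_simplexZero I).isCompact
  exact ((isSignedMinkowskiSum_PF hu₀ hu).toExposed (fun I _ => hcompact I)
    (fun I _ => nonempty_simplexZero I) l).subsingleton
    (fun I _ => subsingleton_toExposed_simplexZero hl_strictMono.injective
      (fun i => (hl_pos i).ne') I)
    fun I _ => nonempty_toExposed (hcompact I) (nonempty_simplexZero I)

end Vertex

section IntegralEquivalence

variable {ι κ : Type*} {φ : (ι → ℝ) →ᵃ[ℝ] (κ → ℝ)} {ψ : (κ → ℝ) →ᵃ[ℝ] (ι → ℝ)}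
  {P : Set (ι → ℝ)} {Q : Set (κ → ℝ)}

theorem bijOn_of_leftInverse {α β : Type*} {f : α → β} {g : β → α} {s : Set α} {t : Set β}
    (hgf : Function.LeftInverse g f) (h : Set.BijOn f s t) : Set.BijOn g t s :=
  h.symm ⟨fun y hy => by obtain ⟨x, -, rfl⟩ := h.surjOn hy; rw [hgf], fun x _ => hgf x⟩

theorem bijOn_affineSpan_image (hφ : Function.Injective φ) (P : Set (ι → ℝ)) :
    Set.BijOn φ (affineSpan ℝ P) (affineSpan ℝ (φ '' P)) := by
  rw [← AffineSubspace.map_span, AffineSubspace.coe_map]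
  exact hφ.injOn.bijOn_image

theorem isIntegralEquivalence_image (hφ : Function.Injective φ)
    (hlattice : φ ⁻¹' latticePoints κ = latticePoints ι) (P : Set (ι → ℝ)) :
    IsIntegralEquivalence φ P (φ '' P) := by
  refine ⟨bijOn_affineSpan_image hφ P, rfl, ?_⟩
  rw [← (bijOn_affineSpan_image hφ P).image_eq, ← hlattice, ← Set.image_inter_preimage]
  exact hφ.injOn.bijOn_image

theorem IsIntegralEquivalence.symm (h : IsIntegralEquivalence φ P Q)
    (hψ : Function.LeftInverse ψ φ) : IsIntegralEquivalence ψ Q P :=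
  ⟨bijOn_of_leftInverse hψ h.1, by rw [← h.2.1, hψ.image_image], bijOn_of_leftInverse hψ h.2.2⟩

theorem IsIntegralPolytope.image [Finite ι] (hP : IsIntegralPolytope P)
    (hφ : Set.MapsTo φ (latticePoints ι) (latticePoints κ)) : IsIntegralPolytope (φ '' P) := by
  refine ⟨hP.1.image φ, fun y hy => ?_⟩
  have hcont : Continuous φ := by
    cases nonempty_fintype ι
    exact AffineMap.continuous_linear_iff.1 φ.linear.continuous_of_finiteDimensional
  obtain ⟨x, hx, rfl⟩ := surjOn_extremePoints_image ⟨φ, hcont⟩ hP.1.isCompact hy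
  exact hφ (hP.2 hx)

end IntegralEquivalence

section Lift

variable {n : ℕ}

/-- The linear map `x ↦ (-∑ x_i, x)` onto the hyperplane of vectors with coordinate sum `0`,
the linear part of `lift c`. -/
def liftLinear (n : ℕ) : (Fin n → ℝ) →ₗ[ℝ] (Fin (n + 1) → ℝ) :=
  LinearMap.pi (Fin.cons (-∑ i, LinearMap.proj i) LinearMap.proj)

/-- The section `x ↦ (c - ∑ x_i, x)` of the projection `proj n`, with image the hyperplane where
the coordinates add up to `c`. -/
noncomputable def lift (c : ℝ) : (Fin n → ℝ) →ᵃ[ℝ] (Fin (n + 1) → ℝ) :=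
  (liftLinear n).toAffineMap + AffineMap.const ℝ _ (c • (Pi.single 0 1 : Fin (n + 1) → ℝ))

theorem coe_lift (c : ℝ) : ⇑(lift c) = fun x : Fin n → ℝ => liftLinear n x + c • Pi.single 0 1 :=
  rfl

theorem lift_apply_zero (c : ℝ) (x : Fin n → ℝ) : lift c x 0 = c - ∑ i, x i := by
  simp [lift, liftLinear, sub_eq_neg_add]

theorem lift_apply_succ (c : ℝ) (x : Fin n → ℝ) (i : Fin n) : lift c x i.succ = x i := by
  simp [lift, liftLinear]

theorem proj_lift (c : ℝ) : Function.LeftInverse (proj n) (lift c) :=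
  fun x => funext (lift_apply_succ c x)

theorem lift_preimage_latticePoints {c : ℝ} (hc : ∃ k : ℤ, c = k) :
    (lift c : (Fin n → ℝ) →ᵃ[ℝ] _) ⁻¹' latticePoints (Fin (n + 1)) = latticePoints (Fin n) := by
  ext x
  refine ⟨fun h i => lift_apply_succ c x i ▸ h i.succ, fun h => ?_⟩
  obtain ⟨k, rfl⟩ := hc
  choose v hv using h
  refine Fin.cases ⟨k - ∑ i, v i, ?_⟩ fun i => ⟨v i, ?_⟩
  · rw [lift_apply_zero]
    simp [hv]
  · rw [lift_apply_succ, hv]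

theorem lift_one_zero : lift 1 (0 : Fin n → ℝ) = Pi.single 0 1 := by
  simp [lift]

theorem lift_one_single (i : Fin n) : lift 1 (Pi.single i 1 : Fin n → ℝ) = Pi.single i.succ 1 := by
  ext j
  refine Fin.cases ?_ (fun j => ?_) j
  · simp [lift_apply_zero]
  · simp [lift_apply_succ, Pi.single_apply]

theorem lift_one_image_simplexZero (I : Finset (Fin n)) :
    lift 1 '' simplexZero I = simplex (withZero I) := by
  rw [simplexZero_eq, simplex, AffineMap.image_convexHull, Set.image_insert_eq, Set.image_image]
  simp only [withZero, lift_one_zero, lift_one_single, Finset.coe_insert, Finset.coe_image,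
    Set.image_insert_eq, Set.image_image]

theorem IsSignedMinkowskiSum.lift {P : Set (Fin n → ℝ)} {s : Finset (Finset (Fin n))}
    {y : Finset (Fin n) → ℝ} (h : IsSignedMinkowskiSum P s y simplexZero) :
    IsSignedMinkowskiSum (lift (∑ I ∈ s, y I) '' P) s y fun I => simplex (withZero I) := by
  simpa only [← lift_one_image_simplexZero, coe_lift, one_smul]
    using h.image_add (liftLinear n) (Pi.single 0 1)

end Lift

end ParkingPolytope

theorem mainTheorem9 {n : ℕ} (u : Fin n → ℝ) (hu_nonneg : ∀ i, 0 ≤ u i) (hu_mono : Monotone u) :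
    ParkingPolytope.IsSignedMinkowskiSum (ParkingPolytope.PF u)
        (ParkingPolytope.nonemptySubsets n) (ParkingPolytope.coeffY u)
        ParkingPolytope.simplexZero ∧
      (∀ I J : Finset (Fin n), I.card = J.card →
        ParkingPolytope.coeffY u I = ParkingPolytope.coeffY u J) ∧
      ∃ Q : Set (Fin (n + 1) → ℝ),
        ParkingPolytope.IsSignedMinkowskiSum Q
            (ParkingPolytope.nonemptySubsets n) (ParkingPolytope.coeffY u)
            (fun I => ParkingPolytope.simplex (ParkingPolytope.withZero I)) ∧
          ParkingPolytope.IsTypeAGenPermutohedron Q ∧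
          ParkingPolytope.proj n '' Q = ParkingPolytope.PF u ∧
          Set.BijOn (ParkingPolytope.proj n) (affineSpan ℝ Q)
            (affineSpan ℝ (ParkingPolytope.PF u)) ∧
          (ParkingPolytope.IsIntegralPolytope (ParkingPolytope.PF u) →
            (∀ I : Finset (Fin n), ∃ k : ℤ, ParkingPolytope.coeffY u I = k) ∧
              ParkingPolytope.IsIntegralEquivalence (ParkingPolytope.proj n) Q
                (ParkingPolytope.PF u) ∧
              ParkingPolytope.IntegrallyEquivalent (ParkingPolytope.PF u) Q) := by
  open ParkingPolytope in
  have hPF := isSignedMinkowskiSum_PF hu_nonneg hu_mono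
  set c := ∑ I ∈ nonemptySubsets n, coeffY u I
  have hQ : IsSignedMinkowskiSum (lift c '' PF u) _ _ _ := hPF.lift
  have hinj : Function.Injective (lift (n := n) c) := (proj_lift c).injective
  refine ⟨hPF, fun I J => coeffY_congr u, lift c '' PF u, hQ,
    hQ.isTypeAGenPermutohedron fun I _ => ⟨0, Finset.mem_insert_self 0 _⟩,
    (proj_lift c).image_image _, bijOn_of_leftInverse (proj_lift c) (bijOn_affineSpan_image hinj _),
    fun hPF_int => ?_⟩
  have hy : ∀ I, ∃ k : ℤ, coeffY u I = k :=
    exists_int_coeffY_eq (hPF_int.2 (mem_extremePoints_PF hu_nonneg hu_mono))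
  have hc : ∃ k : ℤ, c = k := by
    choose k hk using hy
    exact ⟨∑ I ∈ nonemptySubsets n, k I, by simp [c, hk]⟩
  have hlattice := lift_preimage_latticePoints (n := n) hc
  have hlift : IsIntegralEquivalence (lift c) (PF u) (lift c '' PF u) :=
    isIntegralEquivalence_image hinj hlattice _
  exact ⟨hy, hlift.symm (proj_lift c), hPF_int, hPF_int.image hlattice.ge, lift c, hlift⟩
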